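/- Let $n,d\ge 1$ be integers and $p=d^2$, so that $\sqrt p=d$. A dataset is a tuple $\mathbf X=(x^{(1)},\dots,x^{(n)})$ of $n$ samples $x^{(i)}\in\{-1,1\}^{\sqrt p}$. Let $\sigma_\eta\ge 0$, let $\eta^{(1)},\dots,\eta^{(n)}$ be independent with law $\mathcal N(0,\sigma_\eta^2 I)$ on $\mathbb R^{\sqrt p}$ and independent of $\mathbf X$, and let $\mathbf X_\eta=(x^{(1)}+\eta^{(1)},\dots,x^{(n)}+\eta^{(n)})$ be the perturbed samples. Let $\widehat{\mathbf T}'_\eta=\sum_{i=1}^n (x^{(i)}+\eta^{(i)})(x^{(i)}+\eta^{(i)})^{T}$. The published statistic $\widehat{\mathbf T}_\eta$ is obtained from $\widehat{\mathbf T}'_\eta$ by removing the diagonal entries and clamping every off-diagonal entry to $[-1,1]$. Let the data be drawn in either of the following two ways: (a) $x^{(1)},\dots,x^{(n)}$ are i.i.d. uniform on $\{-1,1\}^{\sqrt p}$ (the zero-mean Ising model with parameter $\theta=0$); or (b) $\{x^{(1)},\dots,x^{(n)}\}$ is uniformly distributed on the $n$-element subsets of $\{-1,1\}^{\sqrt p}$,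 listed in uniformly random order. Let $\gamma\in\mathbb R$ and suppose that $$\gamma\le 1-\frac{4}{n\sqrt p},\qquad n\le 2^{\sqrt p/4},\qquad \sigma_\eta^2\ge\frac{4}{(1-\gamma)\log 2}.$$ Then, in both cases (a) and (b), every adversary fails to recover the data up to permutation with probability at least $\gamma$: $$\inf_{\mathcal A}\ \mathbb P_{\mathbf X,\eta}\bigl[\mathcal A(\widehat{\mathbf T}_\eta)\neq\mathbf X\text{ up to permutation of the samples}\bigr]\ \ge\ \gamma ,$$ where the infimum is over all measurable maps $\mathcal A$ from the values of the published statistic to datasets. The same bound holds for adversaries that see the perturbed samples themselves, that is, with $\mathcal A(\mathbf X_\eta)$ in place of $\mathcal A(\widehat{\mathbf T}_\eta)$. -/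

import Mathlib

open MeasureTheory ProbabilityTheory
open scoped NNReal ENNReal

noncomputable section

namespace IsingRecovery

/-- Every subset of `{-1, 1}` is measurable. -/
instance instMeasurableSingletonClassSign : MeasurableSingletonClass ℤˣ where
  measurableSet_singleton u :=
    ⟨{(u : ℤ)}, MeasurableSet.singleton _, by ext v; simp [Units.ext_iff]⟩

/-- A single sample: a vector in `{-1, 1}^d`. -/
abbrev Sample (d : ℕ) : Type := Fin d → ℤˣ

/-- A dataset: an `n`-tuple of samples. -/
abbrev Dataset (n d : ℕ) : Type := Fin n → Sample d

/-- An `n`-tuple of vectors in `ℝ^d` (the noise vectors, or the perturbed samples). -/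
abbrev RealData (n d : ℕ) : Type := Fin n → Fin d → ℝ

/-- The law of `n` i.i.d. samples drawn from a distribution `D` on `{-1, 1}^d`. -/
def iidData (n : ℕ) {d : ℕ} (D : Measure (Sample d)) : Measure (Dataset n d) :=
  Measure.pi fun _ : Fin n => D

/-- The uniform distribution on `{-1, 1}^d`, that is, the zero-mean Ising model with
parameter `0`. -/
def uniformSample (d : ℕ) : Measure (Sample d) := uniformOn Set.univ

/-- The uniform law on the `n`-element subsets of `{-1, 1}^d`, listed in uniformly random
order. -/
def distinctData (n d : ℕ) : Measure (Dataset n d) :=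
  uniformOn {X : Dataset n d | Function.Injective X}

/-- The law of `n` independent noise vectors, each with law `N(0, σ² I)` on `ℝ^d`. -/
def noiseLaw (n d : ℕ) (σ : ℝ≥0) : Measure (RealData n d) :=
  Measure.pi fun _ : Fin n => Measure.pi fun _ : Fin d => gaussianReal 0 (σ ^ 2)

/-- The perturbed samples `x⁽ⁱ⁾ + η⁽ⁱ⁾`. -/
def perturb {n d : ℕ} (X : Dataset n d) (η : RealData n d) : RealData n d :=
  fun i j => ((X i j : ℤ) : ℝ) + η i j

/-- The perturbed sufficient statistic: the sum of `y yᵀ` over the perturbed samples `y`. -/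
def secondMoment {n d : ℕ} (Y : RealData n d) : Matrix (Fin d) (Fin d) ℝ :=
  ∑ i, Matrix.vecMulVec (Y i) (Y i)

/-- The published statistic: the diagonal entries of the perturbed sufficient statistic are
removed, the other entries are clamped to `[-1, 1]`. -/
def published {n d : ℕ} (Y : RealData n d) : {q : Fin d × Fin d // q.1 ≠ q.2} → ℝ :=
  fun q => max (-1) (min 1 (secondMoment Y q.1.1 q.1.2))

/-- Two datasets agree up to a permutation of their samples. -/
def EqUpToPerm {n d : ℕ} (X X' : Dataset n d) : Prop :=
  ∃ π : Equiv.Perm (Fin n), ∀ i, X i = X' (π i)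

/-- The probability, over a dataset `X` of law `P` and independent Gaussian noise, that the
adversary `A` who sees the release `M` of the perturbed samples does not return `X` up to
permutation. -/
def failureProb {n d : ℕ} {Z : Type*} (P : Measure (Dataset n d)) (σ : ℝ≥0)
    (M : RealData n d → Z) (A : Z → Dataset n d) : ℝ≥0∞ :=
  (P.prod (noiseLaw n d σ)) {ω | ¬ EqUpToPerm (A (M (perturb ω.1 ω.2))) ω.1}

/-- Data irrecoverability up to permutation, at level `γ`: the infimum of the failure
probability over all (measurable) adversaries is at least `γ`. -/
def Irrecoverable {n d : ℕ} {Z : Type*} [MeasurableSpace Z] (P : Measure (Dataset n d))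
    (σ : ℝ≥0) (M : RealData n d → Z) (γ : ℝ) : Prop :=
  ENNReal.ofReal γ ≤ ⨅ A : {A : Z → Dataset n d // Measurable A}, failureProb P σ M A.1

end IsingRecovery

end

namespace IsingRecovery

/-! Given `X`, the perturbed samples form a Gaussian vector centred at `X`, whose likelihood ratio
against pure noise has second moment `exp(nd/σ²)`. By Cauchy–Schwarz, replacing the observation by
pure noise bounds the squared success probability at `X` by that factor times the success
probability under noise (`squareDominated_perturb`). Jensen's inequality averages this over `X`
(`success_sq_le`). Pure noise is independent of `X`, so any guess is then right with probability at
most `n!/|F|`, where the data are uniform on `F`.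

Since `n ≤ 2^(d/4)`, this ratio is at most `2^(-3nd/4)`, while the noise level gives `exp(nd/σ²) ≤
2^(nd/4)` when `γ > 0`. The success probability is thus at most `2^(-nd/4) ≤ 4/(nd) ≤ 1 - γ`. -/

/-- `P` has squared density with respect to `Q` of integral at most `C`, in the dual form that
tensorizes directly. -/
def SquareDominated {α : Type*} [MeasurableSpace α] (P Q : Measure α) (C : ℝ≥0∞) : Prop :=
  ∀ f : α → ℝ≥0∞, Measurable f → (∫⁻ x, f x ∂P) ^ 2 ≤ C * ∫⁻ x, f x ^ 2 ∂Q

/-! ### Second-moment change of measure and its tensorization. -/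

theorem sq_lintegral_mul_le {α : Type*} [MeasurableSpace α] (μ : Measure α) {f g : α → ℝ≥0∞}
    (hf : Measurable f) (hg : Measurable g) :
    (∫⁻ x, f x * g x ∂μ) ^ 2 ≤ (∫⁻ x, f x ^ 2 ∂μ) * ∫⁻ x, g x ^ 2 ∂μ := by
  have h := ENNReal.lintegral_mul_le_Lp_mul_Lq μ Real.HolderConjugate.two_two
    hf.aemeasurable hg.aemeasurable
  have hsq (a : ℝ≥0∞) : (a ^ (1 / 2 : ℝ)) ^ 2 = a := by
    rw [← ENNReal.rpow_natCast, ← ENNReal.rpow_mul]; norm_num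
  simp only [ENNReal.rpow_two, Pi.mul_apply] at h
  calc _ ≤ _ := pow_le_pow_left' h 2
    _ = _ := by rw [mul_pow, hsq, hsq]

theorem SquareDominated.refl {α : Type*} [MeasurableSpace α] (P : Measure α)
    [IsProbabilityMeasure P] : SquareDominated P P 1 := by
  intro f hf
  simpa [mul_comm] using sq_lintegral_mul_le P hf (measurable_const (a := (1 : ℝ≥0∞)))

/-- In the dual form this is Tonelli: the first bound is applied to the inner integral, the second
inside it, with no densities involved. -/
theorem SquareDominated.prod {α β : Type*} [MeasurableSpace α] [MeasurableSpace β]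
    {P₁ Q₁ : Measure α} {P₂ Q₂ : Measure β} [SFinite P₂] [SFinite Q₂] {C₁ C₂ : ℝ≥0∞}
    (h₁ : SquareDominated P₁ Q₁ C₁) (h₂ : SquareDominated P₂ Q₂ C₂) :
    SquareDominated (P₁.prod P₂) (Q₁.prod Q₂) (C₁ * C₂) := by
  intro f hf
  rw [lintegral_prod _ hf.aemeasurable, lintegral_prod _ (hf.pow_const 2).aemeasurable]
  calc _ ≤ C₁ * ∫⁻ x, (∫⁻ y, f (x, y) ∂P₂) ^ 2 ∂Q₁ := h₁ _ hf.lintegral_prod_right'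
    _ ≤ C₁ * ∫⁻ x, C₂ * ∫⁻ y, f (x, y) ^ 2 ∂Q₂ ∂Q₁ := by
        gcongr with x
        exact h₂ _ (hf.comp measurable_prodMk_left)
    _ = _ := by
        rw [lintegral_const_mul _ (hf.pow_const 2).lintegral_prod_right', mul_assoc]

theorem SquareDominated.of_measurePreserving {α β : Type*} [MeasurableSpace α]
    [MeasurableSpace β] {P Q : Measure α} {P' Q' : Measure β} {C : ℝ≥0∞} (e : α ≃ᵐ β)
    (hP : MeasurePreserving e P P') (hQ : MeasurePreserving e Q Q')
    (h : SquareDominated P' Q' C) : SquareDominated P Q C := by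
  intro f hf
  have hf' : Measurable (fun y => f (e.symm y)) := hf.comp e.symm.measurable
  have := h _ hf'
  rw [← hP.lintegral_comp hf', ← hQ.lintegral_comp (hf'.pow_const 2)] at this
  simpa using this

theorem SquareDominated.pi {α : Type*} [MeasurableSpace α] {C : ℝ≥0∞} :
    ∀ {n : ℕ} {P Q : Fin n → Measure α} [∀ i, IsProbabilityMeasure (P i)]
      [∀ i, IsProbabilityMeasure (Q i)], (∀ i, SquareDominated (P i) (Q i) C) →
      SquareDominated (Measure.pi P) (Measure.pi Q) (C ^ n) := by
  intro n
  induction n with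
  | zero =>
    intro P Q _ _ _
    rw [Measure.pi_of_empty P, Measure.pi_of_empty Q, pow_zero]
    exact SquareDominated.refl _
  | succ n ih =>
    intro P Q _ _ h
    rw [pow_succ']
    exact SquareDominated.of_measurePreserving _ (measurePreserving_piFinSuccAbove P 0)
      (measurePreserving_piFinSuccAbove Q 0) ((h 0).prod (ih fun i => h _))

theorem squareDominated_gaussianReal (μ : ℝ) {v : ℝ≥0} (hv : v ≠ 0) :
    SquareDominated (gaussianReal μ v) (gaussianReal 0 v)
      (ENNReal.ofReal (Real.exp (μ ^ 2 / v))) := by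
  intro f hf
  have hv' : (v : ℝ) ≠ 0 := by exact_mod_cast hv
  set L : ℝ → ℝ≥0∞ := fun x => ENNReal.ofReal (Real.exp ((2 * μ * x - μ ^ 2) / (2 * v))) with hL
  have hLm : Measurable L := by fun_prop
  have key (m : ℝ) {g : ℝ → ℝ≥0∞} (hg : Measurable g) :
      ∫⁻ x, g x ∂gaussianReal m v = ∫⁻ x, gaussianPDF m v x * g x := by
    rw [gaussianReal_of_var_ne_zero m hv,
      lintegral_withDensity_eq_lintegral_mul _ (measurable_gaussianPDF m v) hg]
    rfl
  have h1 : ∫⁻ x, f x ∂gaussianReal μ v = ∫⁻ x, f x * L x ∂gaussianReal 0 v := by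
    rw [key μ hf, key 0 (g := fun x => f x * L x) (hf.mul hLm)]
    refine lintegral_congr fun x => ?_
    rw [mul_comm (f x), ← mul_assoc]
    congr 1
    rw [gaussianPDF, gaussianPDF, hL, ← ENNReal.ofReal_mul (gaussianPDFReal_nonneg _ _ _),
      gaussianPDFReal, gaussianPDFReal, mul_assoc (√(2 * Real.pi * v))⁻¹, ← Real.exp_add]
    congr 3
    field_simp
    ring
  have h2 : ∫⁻ x, L x ^ 2 ∂gaussianReal 0 v = ENNReal.ofReal (Real.exp (μ ^ 2 / v)) := by
    rw [key 0 (hLm.pow_const 2)]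
    -- Completing the square: squaring the likelihood ratio moves the mean to `2μ`, and the leftover
    -- constant is the second moment.
    have : ∀ x, gaussianPDF 0 v x * L x ^ 2 =
        ENNReal.ofReal (Real.exp (μ ^ 2 / v)) * gaussianPDF (2 * μ) v x := by
      intro x
      rw [gaussianPDF, gaussianPDF, hL, ← ENNReal.ofReal_pow (Real.exp_pos _).le,
        ← ENNReal.ofReal_mul (gaussianPDFReal_nonneg _ _ _), ← ENNReal.ofReal_mul
        (Real.exp_pos _).le, gaussianPDFReal, gaussianPDFReal, mul_assoc,
        mul_left_comm (Real.exp (μ ^ 2 / v)), ← Real.exp_nat_mul, ← Real.exp_add, ← Real.exp_add]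
      congr 3
      push_cast
      field_simp
      ring
    simp_rw [this]
    rw [lintegral_const_mul _ (measurable_gaussianPDF _ v), lintegral_gaussianPDF_eq_one _ hv,
      mul_one]
  rw [h1, ← h2, mul_comm]
  exact sq_lintegral_mul_le _ hf hLm

/-! ### Law of the perturbed samples. -/

instance isProbabilityMeasure_noiseLaw (n d : ℕ) (σ : ℝ≥0) :
    IsProbabilityMeasure (noiseLaw n d σ) := by
  unfold noiseLaw; infer_instance

theorem measurable_perturb {n d : ℕ} :
    Measurable fun ω : Dataset n d × RealData n d => perturb ω.1 ω.2 := by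
  have h : Measurable fun u : ℤˣ => ((u : ℤ) : ℝ) := measurable_of_countable _
  refine measurable_pi_lambda _ fun i => measurable_pi_lambda _ fun j => ?_
  exact (h.comp (by fun_prop : Measurable fun ω : Dataset n d × RealData n d => ω.1 i j)).add
    (by fun_prop)

theorem map_perturb_noiseLaw {n d : ℕ} (σ : ℝ≥0) (X : Dataset n d) :
    (noiseLaw n d σ).map (perturb X) =
      Measure.pi fun i => Measure.pi fun j => gaussianReal ((X i j : ℤ) : ℝ) (σ ^ 2) := by
  have h (i : Fin n) : (Measure.pi fun _ : Fin d => gaussianReal 0 (σ ^ 2)).map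
      (fun y j => ((X i j : ℤ) : ℝ) + y j) =
      Measure.pi fun j => gaussianReal ((X i j : ℤ) : ℝ) (σ ^ 2) := by
    have hs (j : Fin d) : (gaussianReal 0 (σ ^ 2)).map (((X i j : ℤ) : ℝ) + ·) =
        gaussianReal ((X i j : ℤ) : ℝ) (σ ^ 2) := by
      rw [gaussianReal_map_const_add, zero_add]
    have (j : Fin d) : SigmaFinite ((gaussianReal 0 (σ ^ 2)).map (((X i j : ℤ) : ℝ) + ·)) := by
      rw [hs]; infer_instance
    rw [Measure.pi_map_pi (f := fun j y => ((X i j : ℤ) : ℝ) + y)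
      (fun j => (measurable_const_add _).aemeasurable)]
    simp_rw [hs]
  have (i : Fin n) : SigmaFinite ((Measure.pi fun _ : Fin d => gaussianReal 0 (σ ^ 2)).map
      (fun y j => ((X i j : ℤ) : ℝ) + y j)) := by
    rw [h]; infer_instance
  unfold noiseLaw perturb
  rw [Measure.pi_map_pi (f := fun i (y : Fin d → ℝ) j => ((X i j : ℤ) : ℝ) + y j)
    (fun i => (by fun_prop : Measurable _).aemeasurable)]
  simp_rw [h]

theorem squareDominated_perturb {n d : ℕ} {σ : ℝ≥0} (hσ : σ ≠ 0) (X : Dataset n d) :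
    SquareDominated ((noiseLaw n d σ).map (perturb X)) (noiseLaw n d σ)
      (ENNReal.ofReal (Real.exp (1 / (σ : ℝ) ^ 2)) ^ (n * d)) := by
  rw [map_perturb_noiseLaw, mul_comm, pow_mul]
  refine SquareDominated.pi fun i => SquareDominated.pi fun j => ?_
  have h := squareDominated_gaussianReal ((X i j : ℤ) : ℝ) (pow_ne_zero 2 hσ)
  -- Both signs have square 1, so every coordinate costs the same factor `exp(1/σ²)`.
  rcases Int.units_eq_one_or (X i j) with hX | hX <;> simpa [hX] using h

theorem measurable_published {n d : ℕ} : Measurable (published (n := n) (d := d)) := by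
  refine measurable_pi_lambda _ fun q => ?_
  have : Measurable fun Y : RealData n d => secondMoment Y q.1.1 q.1.2 := by
    simp only [secondMoment, Matrix.sum_apply, Matrix.vecMulVec_apply]
    fun_prop
  exact measurable_const.max (measurable_const.min this)

/-! ### Success probability of an adversary. -/

theorem ncard_eqUpToPerm_le {n d : ℕ} (X : Dataset n d) :
    {X' : Dataset n d | EqUpToPerm X X'}.ncard ≤ n.factorial := by
  have h : {X' : Dataset n d | EqUpToPerm X X'} ⊆
      Set.range fun π : Equiv.Perm (Fin n) => X ∘ π := by
    rintro X' ⟨π, hπ⟩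
    exact ⟨π.symm, by ext1 i; simp [hπ]⟩
  calc _ ≤ _ := Set.ncard_le_ncard h (Set.toFinite _)
    _ = (Set.image (fun π : Equiv.Perm (Fin n) => X ∘ π) Set.univ).ncard := by
        rw [Set.image_univ]
    _ ≤ _ := Set.ncard_image_le (Set.toFinite _)
    _ = n.factorial := by
        rw [Set.ncard_univ, Nat.card_eq_fintype_card, Fintype.card_perm, Fintype.card_fin]

theorem uniformOn_eqUpToPerm_le {n d : ℕ} (F : Set (Dataset n d)) (X : Dataset n d) :
    uniformOn F {X' | EqUpToPerm X X'} ≤ (n.factorial : ℝ≥0∞) / F.ncard := by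
  classical
  obtain ⟨s, rfl⟩ := F.toFinite.exists_finset_coe
  obtain ⟨t, ht⟩ := (Set.toFinite {X' | EqUpToPerm X X'}).exists_finset_coe
  have h := ncard_eqUpToPerm_le X
  rw [← ht, Set.ncard_coe_finset] at h
  rw [← ht, uniformOn_apply_finset, Set.ncard_coe_finset]
  gcongr
  exact (Finset.card_le_card Finset.inter_subset_right).trans h

theorem success_sq_le {n d : ℕ} {Z : Type*} [MeasurableSpace Z] {F : Set (Dataset n d)}
    (hF : F.Nonempty) {σ : ℝ≥0} (hσ : σ ≠ 0) {M : RealData n d → Z} (hM : Measurable M)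
    {A : Z → Dataset n d} (hA : Measurable A) :
    (((uniformOn F).prod (noiseLaw n d σ))
        {ω | EqUpToPerm (A (M (perturb ω.1 ω.2))) ω.1}) ^ 2 ≤
      ENNReal.ofReal (Real.exp (1 / (σ : ℝ) ^ 2)) ^ (n * d) *
        ((n.factorial : ℝ≥0∞) / F.ncard) := by
  have : IsProbabilityMeasure (uniformOn F) := isProbabilityMeasure_uniformOn F.toFinite hF
  set C := ENNReal.ofReal (Real.exp (1 / (σ : ℝ) ^ 2)) ^ (n * d)
  set S : Set (Dataset n d × RealData n d) := {ω | EqUpToPerm (A (M ω.2)) ω.1}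
  have hSm : MeasurableSet S := by
    have : Measurable fun ω : Dataset n d × RealData n d => (A (M ω.2), ω.1) := by fun_prop
    exact this (Set.toFinite {q : Dataset n d × Dataset n d | EqUpToPerm q.1 q.2}).measurableSet
  have hpre : MeasurableSet {ω : Dataset n d × RealData n d |
      EqUpToPerm (A (M (perturb ω.1 ω.2))) ω.1} :=
    (measurable_fst.prodMk measurable_perturb) hSm
  have hsec (X : Dataset n d) : MeasurableSet (Prod.mk X ⁻¹' S) := measurable_prodMk_left hSm
  rw [Measure.prod_apply hpre]
  -- Jensen over `X`, as domination of a probability measure by itself with constant 1.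
  calc _ ≤ 1 * ∫⁻ X, (noiseLaw n d σ (Prod.mk X ⁻¹' {ω : Dataset n d × RealData n d |
          EqUpToPerm (A (M (perturb ω.1 ω.2))) ω.1})) ^ 2 ∂uniformOn F :=
        SquareDominated.refl _ _ (measurable_measure_prodMk_left hpre)
    _ ≤ 1 * ∫⁻ X, C * noiseLaw n d σ (Prod.mk X ⁻¹' S) ∂uniformOn F := by
        gcongr with X
        have h := squareDominated_perturb hσ X _
          (measurable_one.indicator (hsec X) : Measurable
            ((Prod.mk X ⁻¹' S).indicator (1 : RealData n d → ℝ≥0∞)))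
        have hsq : ∀ y, ((Prod.mk X ⁻¹' S).indicator (1 : RealData n d → ℝ≥0∞) y) ^ 2 =
            (Prod.mk X ⁻¹' S).indicator 1 y := by
          intro y
          by_cases hy : y ∈ Prod.mk X ⁻¹' S <;> simp [hy]
        simp_rw [hsq] at h
        rw [lintegral_indicator_one (hsec X), lintegral_indicator_one (hsec X),
          Measure.map_apply (show Measurable (perturb X) from
            measurable_perturb.comp measurable_prodMk_left) (hsec X)] at h
        exact h
    -- The observation no longer depends on `X`, so Tonelli allows fixing it first: the guess
    -- becomes a constant.
    _ = C * ∫⁻ y, uniformOn F {X | EqUpToPerm (A (M y)) X} ∂noiseLaw n d σ := by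
        rw [one_mul, lintegral_const_mul _ (measurable_measure_prodMk_left hSm),
          ← Measure.prod_apply hSm, Measure.prod_apply_symm hSm]
        rfl
    _ ≤ C * ∫⁻ _, (n.factorial : ℝ≥0∞) / F.ncard ∂noiseLaw n d σ := by
        gcongr with y
        exact uniformOn_eqUpToPerm_le F _
    _ = _ := by simp

/-! ### Counting and numerical estimates. -/

/-- Factor by factor, `(n - i)/(N - i) ≤ n/N`. At `k = n` it reads `n!/(N)ₙ ≤ (n/N)ⁿ`, with `(N)ₙ`
the falling factorial. -/
theorem descFactorial_mul_pow_le {n N : ℕ} (h : n ≤ N) (k : ℕ) (hk : k ≤ n) :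
    n.descFactorial k * N ^ k ≤ n ^ k * N.descFactorial k := by
  induction k with
  | zero => simp
  | succ k ih =>
    rw [Nat.descFactorial_succ, Nat.descFactorial_succ, pow_succ, pow_succ]
    have h1 : (n - k) * N ≤ n * (N - k) := by
      rw [Nat.sub_mul, Nat.mul_sub]
      have := Nat.mul_le_mul_left k h
      rw [mul_comm n k]
      omega
    calc _ = ((n - k) * N) * (n.descFactorial k * N ^ k) := by ring
      _ ≤ (n * (N - k)) * (n ^ k * N.descFactorial k) := Nat.mul_le_mul h1 (ih (by omega))
      _ = _ := by ring

theorem ncard_injective (n d : ℕ) :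
    {X : Dataset n d | Function.Injective X}.ncard = (2 ^ d).descFactorial n := by
  have h := Nat.card_congr (Equiv.subtypeInjectiveEquivEmbedding (Fin n) (Sample d))
  rw [← Nat.card_coe_set_eq, Set.coe_ofPred, h, Nat.card_eq_fintype_card,
    Fintype.card_embedding_eq]
  simp

theorem exp_mul_two_rpow_neg_le_sq {m δ s2 : ℝ} (hm : 0 < m) (hδ : 4 / m ≤ δ) (hδ1 : δ ≤ 1)
    (hs : 4 / (δ * Real.log 2) ≤ s2) :
    Real.exp (m / s2) * (2 : ℝ) ^ (-(3 * m / 4)) ≤ δ ^ 2 := by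
  have hl : 0 < Real.log 2 := Real.log_pos (by norm_num)
  have hδ0 : 0 < δ := lt_of_lt_of_le (by positivity) hδ
  have h1 : m / s2 ≤ m / 4 * Real.log 2 := by
    have hs0 : 0 < s2 := lt_of_lt_of_le (by positivity) hs
    rw [div_le_iff₀ (by positivity)] at hs
    rw [div_le_iff₀ hs0]
    have : 4 ≤ s2 * Real.log 2 := by
      refine hs.trans ?_
      have : 0 < s2 * Real.log 2 := by positivity
      nlinarith
    nlinarith
  have h2 : (2 : ℝ) ^ (-(m / 4)) ≤ 4 / m := by
    -- Bernoulli's inequality, whose exponent must be at least 1: this follows from `4/m ≤ δ ≤ 1`.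
    have : m / 4 ≤ (2 : ℝ) ^ (m / 4) := by
      have h4 : 1 ≤ m / 4 := by
        have := hδ.trans hδ1
        rw [div_le_one hm] at this
        linarith
      have := one_add_mul_self_le_rpow_one_add (s := 1) (by norm_num) h4
      norm_num at this
      linarith
    rw [Real.rpow_neg (by norm_num), ← inv_div m 4]
    exact inv_anti₀ (by positivity) this
  calc _ ≤ Real.exp (m / 4 * Real.log 2) * (2 : ℝ) ^ (-(3 * m / 4)) := by gcongr
    _ = ((2 : ℝ) ^ (-(m / 4))) ^ 2 := by
        rw [mul_comm (m / 4), ← Real.rpow_def_of_pos (by norm_num), ← Real.rpow_add (by norm_num),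
          ← Real.rpow_natCast, ← Real.rpow_mul (by norm_num)]
        congr 1
        push_cast
        ring
    _ ≤ δ ^ 2 := pow_le_pow_left₀ (by positivity) (h2.trans hδ) 2

/-- Only a lower bound on `|F|` is needed, so one statement covers i.i.d. data (all tuples) and
distinct samples (injective tuples). -/
theorem irrecoverable_uniformOn {n d : ℕ} (hn : 0 < n) (hd : 0 < d) {γ : ℝ} {σ : ℝ≥0}
    (hγ : γ ≤ 1 - 4 / ((n : ℝ) * d)) (hnd : (n : ℝ) ≤ (2 : ℝ) ^ ((d : ℝ) / 4))
    (hσ : 4 / ((1 - γ) * Real.log 2) ≤ (σ : ℝ) ^ 2) {F : Set (Dataset n d)}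
    (hF : (2 ^ d).descFactorial n ≤ F.ncard) {Z : Type*} [MeasurableSpace Z]
    {M : RealData n d → Z} (hM : Measurable M) : Irrecoverable (uniformOn F) σ M γ := by
  refine le_iInf fun ⟨A, hA⟩ => ?_
  -- For `γ ≤ 0` the bound is vacuous; otherwise `1 - γ ≤ 1`, as the numerical estimate requires.
  rcases le_or_gt γ 0 with hγ0 | hγ0
  · simp [ENNReal.ofReal_of_nonpos hγ0]
  have hl : 0 < Real.log 2 := Real.log_pos (by norm_num)
  have hm : 0 < (n : ℝ) * d := by positivity
  have hδ0 : 0 < 1 - γ := by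
    have : 0 < 4 / ((n : ℝ) * d) := by positivity
    linarith
  have hσ0 : σ ≠ 0 := by
    rintro rfl
    have : 0 < 4 / ((1 - γ) * Real.log 2) := by positivity
    norm_num at hσ
    linarith
  have hN : n ≤ 2 ^ d := by
    have : (n : ℝ) ≤ (2 : ℝ) ^ (d : ℝ) := hnd.trans
      (Real.rpow_le_rpow_of_exponent_le (by norm_num) (by linarith [(d.cast_nonneg : (0:ℝ) ≤ d)]))
    rw [Real.rpow_natCast] at this
    exact_mod_cast this
  have hF0 : 0 < F.ncard := (Nat.descFactorial_pos.2 hN).trans_le hF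
  have hFne : F.Nonempty := Set.nonempty_of_ncard_ne_zero hF0.ne'
  have : IsProbabilityMeasure (uniformOn F) := isProbabilityMeasure_uniformOn F.toFinite hFne
  have hcard : (n.factorial : ℝ) / F.ncard ≤ (2 : ℝ) ^ (-(3 * ((n : ℝ) * d) / 4)) := by
    have h := descFactorial_mul_pow_le hN n le_rfl
    rw [Nat.descFactorial_self] at h
    have h' : (n.factorial : ℝ) * (2 ^ d) ^ n ≤ (n : ℝ) ^ n * F.ncard := by
      exact_mod_cast h.trans (Nat.mul_le_mul_left _ hF)
    have hn' : (n : ℝ) ^ n ≤ (2 : ℝ) ^ ((n : ℝ) * d / 4) := by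
      refine (pow_le_pow_left₀ (by positivity) hnd n).trans_eq ?_
      rw [← Real.rpow_natCast, ← Real.rpow_mul (by norm_num)]
      congr 1
      ring
    have hF0' : (0 : ℝ) < F.ncard := by exact_mod_cast hF0
    rw [div_le_iff₀ hF0']
    have hpow : ((2 : ℝ) ^ d) ^ n = (2 : ℝ) ^ ((n : ℝ) * d) := by
      rw [← pow_mul, ← Real.rpow_natCast]
      congr 1
      push_cast
      ring
    rw [hpow, ← le_div_iff₀ (by positivity)] at h'
    refine h'.trans ?_
    rw [div_le_iff₀ (by positivity), mul_right_comm, ← Real.rpow_add (by norm_num)]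
    refine mul_le_mul_of_nonneg_right (hn'.trans_eq ?_) hF0'.le
    congr 1
    ring
  set S : Set (Dataset n d × RealData n d) := {ω | EqUpToPerm (A (M (perturb ω.1 ω.2))) ω.1}
  have hSm : MeasurableSet S := by
    have : Measurable fun ω : Dataset n d × RealData n d => (A (M (perturb ω.1 ω.2)), ω.1) :=
      (hA.comp (hM.comp measurable_perturb)).prodMk measurable_fst
    exact this (Set.toFinite {q : Dataset n d × Dataset n d | EqUpToPerm q.1 q.2}).measurableSet
  have hsuccess : ((uniformOn F).prod (noiseLaw n d σ)) S ≤ ENNReal.ofReal (1 - γ) := by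
    rw [← ENNReal.pow_le_pow_left_iff (two_ne_zero)]
    refine (success_sq_le hFne hσ0 hM hA).trans ?_
    rw [← ENNReal.ofReal_pow (Real.exp_pos _).le, ← ENNReal.ofReal_pow hδ0.le,
      ← ENNReal.ofReal_natCast, ← ENNReal.ofReal_natCast F.ncard,
      ← ENNReal.ofReal_div_of_pos (by exact_mod_cast hF0), ← ENNReal.ofReal_mul (by positivity)]
    refine ENNReal.ofReal_le_ofReal (le_trans ?_
      (exp_mul_two_rpow_neg_le_sq hm (by linarith) (by linarith) hσ))
    rw [← Real.exp_nat_mul]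
    refine mul_le_mul (le_of_eq ?_) hcard (by positivity) (by positivity)
    congr 1
    push_cast
    ring
  have hfail : failureProb (uniformOn F) σ M A = ((uniformOn F).prod (noiseLaw n d σ)) Sᶜ := rfl
  rw [hfail, prob_compl_eq_one_sub hSm]
  calc ENNReal.ofReal γ = 1 - ENNReal.ofReal (1 - γ) := by
        rw [← ENNReal.ofReal_one, ← ENNReal.ofReal_sub _ hδ0.le]
        congr 1
        ring
    _ ≤ _ := tsub_le_tsub_left hsuccess 1

theorem iidData_uniformSample (n d : ℕ) :
    iidData n (uniformSample d) = uniformOn (Set.univ : Set (Dataset n d)) := by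
  rw [iidData, uniformSample, ← uniformOn_pi, Set.pi_univ]

end IsingRecovery

theorem theorem4 (n d p : ℕ) (hn : 0 < n) (hd : 0 < d) (hp : p = d ^ 2)
    (γ : ℝ) (σ : ℝ≥0)
    (hγ : γ ≤ 1 - 4 / ((n : ℝ) * Real.sqrt p))
    (hnp : (n : ℝ) ≤ (2 : ℝ) ^ (Real.sqrt p / 4))
    (hσ : 4 / ((1 - γ) * Real.log 2) ≤ (σ : ℝ) ^ 2) :
    (IsingRecovery.Irrecoverable
        (IsingRecovery.iidData n (IsingRecovery.uniformSample d)) σ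
        (IsingRecovery.published (n := n) (d := d)) γ ∧
      IsingRecovery.Irrecoverable
        (IsingRecovery.iidData n (IsingRecovery.uniformSample d)) σ
        (fun Y : IsingRecovery.RealData n d => Y) γ) ∧
    (IsingRecovery.Irrecoverable (IsingRecovery.distinctData n d) σ
        (IsingRecovery.published (n := n) (d := d)) γ ∧
      IsingRecovery.Irrecoverable (IsingRecovery.distinctData n d) σ
        (fun Y : IsingRecovery.RealData n d => Y) γ) := by
  have hsqrt : Real.sqrt p = d := by
    rw [hp, Nat.cast_pow, Real.sqrt_sq d.cast_nonneg]
  rw [hsqrt] at hγ hnp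
  have hinj := (IsingRecovery.ncard_injective n d).ge
  have huniv : (2 ^ d).descFactorial n ≤ (Set.univ : Set (IsingRecovery.Dataset n d)).ncard :=
    hinj.trans (Set.ncard_le_ncard (Set.subset_univ _) (Set.toFinite _))
  rw [IsingRecovery.iidData_uniformSample, IsingRecovery.distinctData]
  exact ⟨⟨IsingRecovery.irrecoverable_uniformOn hn hd hγ hnp hσ huniv
        IsingRecovery.measurable_published,
      IsingRecovery.irrecoverable_uniformOn hn hd hγ hnp hσ huniv measurable_id⟩,
    IsingRecovery.irrecoverable_uniformOn hn hd hγ hnp hσ hinj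
      IsingRecovery.measurable_published,
    IsingRecovery.irrecoverable_uniformOn hn hd hγ hnp hσ hinj measurable_id⟩
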